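/- **Theorem 4.1 (Bernstein revisited).** Let $d$ be a natural number, let $X=(X_1,\dots,X_d)$ be a random vector with values in $\mathbb R^d$ defined on a probability space, and let $G$ be an infinite subgroup of $SO(d)$ which acts irreducibly on $\mathbb R^d$ (i.e. $\mathbb R^d\neq\{0\}$ and the only linear subspaces of $\mathbb R^d$ invariant under all $g\in G$ are $\{0\}$ and $\mathbb R^d$). Assume that a) the law of $X$ is invariant under $G$: for every $g\in G$ the random vectors $gX$ and $X$ have the same law; b) the real random variables $X_1,\dots,X_d$ have the same law and are independent. Then $X$ is Gaussian, i.e. every linear form $\sum_{i} c_iX_i$, $c\in\mathbb R^d$, has a (possibly degenerate) normal law. -/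

import Mathlib

open MeasureTheory ProbabilityTheory

/-- The tautological representation of the rotation group `SO(d)` on Euclidean space `ℝ^d`:
the rotation matrix `g` acts by `x ↦ g x`. -/
noncomputable def rotationRep (d : ℕ) :
    Representation ℝ (Matrix.specialOrthogonalGroup (Fin d) ℝ) (EuclideanSpace ℝ (Fin d)) where
  toFun g := Matrix.toEuclideanLin (g : Matrix (Fin d) (Fin d) ℝ)
  map_one' := by
    ext x i
    simp
  map_mul' g h := by
    ext x i
    simp

/-- In coordinates, the action of a rotation is multiplication by its matrix. -/
theorem rotationRep_apply (d : ℕ) (g : Matrix.specialOrthogonalGroup (Fin d) ℝ)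
    (x : EuclideanSpace ℝ (Fin d)) (i : Fin d) :
    rotationRep d g x i = ∑ j, (g : Matrix (Fin d) (Fin d) ℝ) i j * x j := by
  simp [rotationRep, Matrix.mulVec, dotProduct]

/-- A subgroup `G` of `SO(d)` acts irreducibly on `ℝ^d`: the restriction to `G` of the
tautological representation is irreducible, i.e. `ℝ^d ≠ 0` and the only `G`-invariant linear
subspaces of `ℝ^d` are `0` and `ℝ^d`. -/
def ActsIrreducibly {d : ℕ} (G : Subgroup (Matrix.specialOrthogonalGroup (Fin d) ℝ)) : Prop :=
  Representation.IsIrreducible ((rotationRep d).comp G.subtype)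

/-- The law of the random vector `X` under `P` is invariant under the subgroup `G` of `SO(d)`:
for every `g ∈ G`, the vectors `g X` and `X` have the same law. -/
def LawInvariantUnder {d : ℕ} {Ω : Type*} [MeasurableSpace Ω]
    (G : Subgroup (Matrix.specialOrthogonalGroup (Fin d) ℝ))
    (X : Ω → EuclideanSpace ℝ (Fin d)) (P : Measure Ω) : Prop :=
  ∀ g ∈ G, P.map (fun ω => rotationRep d g (X ω)) = P.map X

/-!
# Bernstein's theorem for infinite groups of rotations

Let `μ` be the common law of the coordinates and weight it to `ν = e^{-y²/2} μ(dy)`. The weight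
makes all exponential moments finite, so the cumulant generating function `h` of `ν` is
differentiable on all of `ℝ`, whatever `μ` is. By independence
`E[exp (⟨u, X⟩ - |X|²/2)] = exp (∑ i, h (u i))`, and since rotations preserve inner products and
norms, the invariance of the law of `X` makes `u ↦ ∑ i, h (u i)` invariant under `G`
(`sum_cgf_gaussianWeighted_invariant`).

An infinite subgroup of the compact group `SO(d)` accumulates at the identity, and normalized
differences `g - 1` converge to a nonzero skew-symmetric matrix `A` (`exists_skew_generator`).
Differentiating the invariance along `u ↦ A u` gives `∑ i, h' (u i) (A u) i = 0` for all `u`.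
If `A p q ≠ 0`, restricting to the plane of the coordinates `p`, `q` shows that `h'` is affine
(`exists_affine_of_sum_mul_mulVec_eq_zero`), so `h` is a quadratic polynomial.

Hence `ν` is a multiple of a Gaussian measure, its variance being the second derivative of `h`
(`exists_eq_smul_gaussianReal_of_cgf`). Undoing the weight gives either a Dirac mass or a density
`exp (α + β y + γ y²)`, which is Gaussian because it is integrable
(`isGaussian_of_gaussianWeighted_eq_smul`). Independent Gaussian coordinates form a Gaussian
vector.
-/

/-! ### Infinitesimal generators of infinite groups of rotations -/

section Generator

open Filter Topology Matrix

attribute [local instance] Matrix.normedAddCommGroup Matrix.normedSpace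

theorem transpose_mul_self_of_mem_specialOrthogonalGroup {d : ℕ}
    (g : Matrix.specialOrthogonalGroup (Fin d) ℝ) :
    (g : Matrix (Fin d) (Fin d) ℝ)ᵀ * (g : Matrix (Fin d) (Fin d) ℝ) = 1 :=
  (Matrix.mem_orthogonalGroup_iff' _ _).1 (Matrix.mem_specialOrthogonalGroup_iff.1 g.2).1

/-- An infinite subgroup of the compact group `SO(d)` is not discrete: the quotients of
consecutive terms of a convergent sequence of distinct elements tend to the identity. -/
theorem exists_seq_tendsto_one_of_infinite {d : ℕ}
    (G : Subgroup (Matrix.specialOrthogonalGroup (Fin d) ℝ)) (hG : Infinite G) :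
    ∃ g : ℕ → Matrix.specialOrthogonalGroup (Fin d) ℝ, (∀ n, g n ∈ G) ∧ (∀ n, g n ≠ 1) ∧
      Tendsto (fun n => (g n : Matrix (Fin d) (Fin d) ℝ)) atTop (𝓝 1) := by
  let e := Infinite.natEmbedding G
  let m : ℕ → Matrix (Fin d) (Fin d) ℝ := fun n => ((e n : G) : specialOrthogonalGroup (Fin d) ℝ)
  have hbd : ∀ n, m n ∈ Metric.closedBall (0 : Matrix (Fin d) (Fin d) ℝ) 1 := by
    intro n
    rw [mem_closedBall_zero_iff, Matrix.norm_le_iff zero_le_one]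
    exact entry_norm_bound_of_unitary
      (Matrix.mem_specialOrthogonalGroup_iff.1 (e n : G).1.2).1
  have : ProperSpace (Matrix (Fin d) (Fin d) ℝ) := FiniteDimensional.proper ℝ _
  obtain ⟨l, -, φ, hφ, hl⟩ := (isCompact_closedBall _ _).tendsto_subseq hbd
  have hl1 : lᵀ * l = 1 := by
    have h1 : Tendsto (fun n => (m (φ n))ᵀ * m (φ n)) atTop (𝓝 (lᵀ * l)) :=
      (((continuous_id.matrix_transpose).tendsto l).comp hl).mul hl
    refine tendsto_nhds_unique h1 ?_
    simp only [m, transpose_mul_self_of_mem_specialOrthogonalGroup]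
    exact tendsto_const_nhds
  refine ⟨fun n => ((e (φ (n + 1)))⁻¹ * e (φ n) : G), fun n => SetLike.coe_mem _, fun n h => ?_, ?_⟩
  · have h2 : (e (φ (n + 1)))⁻¹ * e (φ n) = 1 := Subtype.ext h
    rw [inv_mul_eq_one] at h2
    exact (hφ (Nat.lt_succ_self n)).ne' (e.injective h2)
  · have h1 : Tendsto (fun n => (m (φ (n + 1)))ᵀ * m (φ n)) atTop (𝓝 (lᵀ * l)) :=
      (((continuous_id.matrix_transpose).tendsto l).comp
        (hl.comp (tendsto_add_atTop_nat 1))).mul hl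
    rw [hl1] at h1
    exact h1

/-- Normalizing the differences `U n - 1` of orthogonal matrices tending to the identity gives,
along a subsequence, a nonzero limit. It is skew-symmetric, because with `E = U n - 1` the relation
`(U n)ᵀ U n = 1` reads `E + Eᵀ + Eᵀ E = 0`, whose last term is of second order. -/
theorem exists_skew_generator {d : ℕ} (U : ℕ → Matrix (Fin d) (Fin d) ℝ)
    (horth : ∀ n, (U n)ᵀ * U n = 1) (hne : ∀ n, U n ≠ 1) (hlim : Tendsto U atTop (𝓝 1)) :
    ∃ A : Matrix (Fin d) (Fin d) ℝ, A ≠ 0 ∧ Aᵀ = -A ∧ ∃ φ : ℕ → ℕ, ∃ c : ℕ → ℝ,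
      Tendsto c atTop atTop ∧ Tendsto (fun n => c n • (U (φ n) - 1)) atTop (𝓝 A) := by
  have hpos : ∀ n, 0 < ‖U n - 1‖ := fun n => norm_pos_iff.2 (sub_ne_zero.2 (hne n))
  have hE : Tendsto (fun n => U n - 1) atTop (𝓝 0) := by
    simpa using hlim.sub_const 1
  have hr : Tendsto (fun n => ‖U n - 1‖) atTop (𝓝 0) := by simpa using hE.norm
  have hc : Tendsto (fun n => ‖U n - 1‖⁻¹) atTop atTop :=
    (tendsto_nhdsWithin_iff.2 ⟨hr, .of_forall hpos⟩).inv_tendsto_nhdsGT_zero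
  have hsph : ∀ n, ‖U n - 1‖⁻¹ • (U n - 1) ∈ Metric.sphere (0 : Matrix (Fin d) (Fin d) ℝ) 1 := by
    intro n
    rw [mem_sphere_zero_iff_norm, norm_smul, norm_inv, norm_norm, inv_mul_cancel₀ (hpos n).ne']
  have : ProperSpace (Matrix (Fin d) (Fin d) ℝ) := FiniteDimensional.proper ℝ _
  obtain ⟨A, hA, φ, hφ, hAlim⟩ := (isCompact_sphere _ _).tendsto_subseq hsph
  refine ⟨A, ?_, ?_, φ, fun n => ‖U (φ n) - 1‖⁻¹, hc.comp hφ.tendsto_atTop, hAlim⟩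
  · rintro rfl
    simp at hA
  · have hAt : Tendsto (fun n => (‖U (φ n) - 1‖⁻¹ • (U (φ n) - 1))ᵀ) atTop (𝓝 Aᵀ) :=
      ((continuous_id.matrix_transpose).tendsto A).comp hAlim
    have hsum := (hAlim.add hAt).add (hAt.mul (hE.comp hφ.tendsto_atTop))
    rw [mul_zero, add_zero] at hsum
    have hzero : A + Aᵀ = 0 := by
      refine tendsto_nhds_unique hsum ?_
      refine tendsto_const_nhds.congr fun n => ?_
      have h := horth (φ n)
      simp only [Function.comp_apply, transpose_smul, transpose_sub, transpose_one, smul_mul_assoc,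
        ← smul_add]
      rw [show U (φ n) - 1 + ((U (φ n))ᵀ - 1) + ((U (φ n))ᵀ - 1) * (U (φ n) - 1)
        = (U (φ n))ᵀ * U (φ n) - 1 by noncomm_ring, h, sub_self, smul_zero]
    exact eq_neg_of_add_eq_zero_right hzero

/-- A differentiable function of the form `u ↦ ∑ i, h (u i)` that is invariant under matrices
tending to the identity has vanishing derivative along the linear vector field they generate. -/
theorem sum_deriv_mul_mulVec_eq_zero {d : ℕ} {h : ℝ → ℝ} (hh : Differentiable ℝ h)
    {U : ℕ → Matrix (Fin d) (Fin d) ℝ} {c : ℕ → ℝ} {A : Matrix (Fin d) (Fin d) ℝ}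
    (hU : ∀ n u, ∑ i, h ((U n *ᵥ u) i) = ∑ i, h (u i))
    (hc : Tendsto c atTop atTop) (hA : Tendsto (fun n => c n • (U n - 1)) atTop (𝓝 A))
    (u : Fin d → ℝ) : ∑ i, deriv h (u i) * (A *ᵥ u) i = 0 := by
  let f : (Fin d → ℝ) → ℝ := fun v => ∑ i, h (v i)
  let f' : (Fin d → ℝ) →L[ℝ] ℝ :=
    ∑ i, (deriv h (u i)) • (ContinuousLinearMap.proj i : (Fin d → ℝ) →L[ℝ] ℝ)
  have hf : HasFDerivAt f f' u := by
    refine HasFDerivAt.fun_sum fun i _ => ?_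
    exact (hh (u i)).hasDerivAt.comp_hasFDerivAt u
      (ContinuousLinearMap.proj i : (Fin d → ℝ) →L[ℝ] ℝ).hasFDerivAt
  have hv : Tendsto (fun n => c n • (U n *ᵥ u - u)) atTop (𝓝 (A *ᵥ u)) := by
    have h1 : Continuous fun B : Matrix (Fin d) (Fin d) ℝ => B *ᵥ u :=
      continuous_id.matrix_mulVec continuous_const
    refine ((h1.tendsto A).comp hA).congr fun n => ?_
    simp [smul_mulVec, sub_mulVec]
  have hd : Tendsto (fun n => U n *ᵥ u - u) atTop (𝓝 0) := by
    have h0 := hc.inv_tendsto_atTop.smul hv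
    rw [zero_smul] at h0
    refine h0.congr' ?_
    filter_upwards [hc.eventually_gt_atTop 0] with n hn
    simp [smul_smul, inv_mul_cancel₀ hn.ne']
  have hlim := (hasFDerivWithinAt_univ.2 hf).lim hd (.of_forall fun _ => Set.mem_univ _) hv
  have hzero : f' (A *ᵥ u) = 0 := by
    refine tendsto_nhds_unique hlim (tendsto_const_nhds.congr fun n => ?_)
    have := hU n u
    simp only [f, add_sub_cancel, this, sub_self, smul_zero]
  simpa [f'] using hzero

/-- The functional equation `∑ i, k (u i) (A u) i = 0` with a nonzero skew-symmetric matrix `A`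
forces `k` to be affine. -/
theorem exists_affine_of_sum_mul_mulVec_eq_zero {d : ℕ} {k : ℝ → ℝ}
    {A : Matrix (Fin d) (Fin d) ℝ} (hA0 : A ≠ 0) (hskew : Aᵀ = -A)
    (hk : ∀ u : Fin d → ℝ, ∑ i, k (u i) * (A *ᵥ u) i = 0) :
    ∃ b c : ℝ, ∀ s, k s = b + c * s := by
  have hneg : ∀ i j, A j i = -A i j := fun i j => congrFun (congrFun hskew i) j
  have hdiag : ∀ i, A i i = 0 := fun i => by linarith [hneg i i]
  obtain ⟨p, q, hpq⟩ : ∃ p q, A p q ≠ 0 := by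
    by_contra! h
    exact hA0 (Matrix.ext h)
  have hne : q ≠ p := by
    rintro rfl
    exact hpq (hdiag q)
  -- Evaluate at `u = s e_p + e_q`: the coordinates other than `p`, `q` only see `k 0`.
  let R (s : ℝ) : ℝ := ∑ i ∈ (Finset.univ.erase p).erase q, (A i p * s + A i q)
  have key : ∀ s, k s * A p q + k 1 * (A q p * s) + k 0 * R s = 0 := by
    intro s
    let u : Fin d → ℝ := Pi.single p s + Pi.single q 1
    have hup : u p = s := by simp [u, hne.symm]
    have huq : u q = 1 := by simp [u, hne]
    have hAu : ∀ i, (A *ᵥ u) i = A i p * s + A i q := by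
      intro i
      simp [u, mulVec_add, mul_comm]
    have h := hk u
    rw [← Finset.add_sum_erase _ _ (Finset.mem_univ p),
      ← Finset.add_sum_erase _ _ (Finset.mem_erase.2 ⟨hne, Finset.mem_univ q⟩)] at h
    have hrest : ∑ i ∈ (Finset.univ.erase p).erase q, k (u i) * (A *ᵥ u) i = k 0 * R s := by
      rw [Finset.mul_sum]
      refine Finset.sum_congr rfl fun i hi => ?_
      simp only [Finset.mem_erase] at hi
      rw [hAu, show u i = 0 by simp [u, hi.1, hi.2.1]]
    rw [hrest, hup, huq, hAu, hAu, hdiag p, hdiag q] at h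
    linarith
  have hR : ∀ s, R s = (∑ i ∈ (Finset.univ.erase p).erase q, A i p) * s
      + ∑ i ∈ (Finset.univ.erase p).erase q, A i q := by
    intro s
    simp only [R, Finset.sum_add_distrib, Finset.sum_mul]
  refine ⟨-(k 0 * ∑ i ∈ (Finset.univ.erase p).erase q, A i q) / A p q,
    -(k 1 * A q p + k 0 * ∑ i ∈ (Finset.univ.erase p).erase q, A i p) / A p q, fun s => ?_⟩
  have h := key s
  rw [hR] at h
  field_simp
  linarith

theorem eq_quadratic_of_deriv_affine {h : ℝ → ℝ} (hh : Differentiable ℝ h) {b c : ℝ}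
    (hd : ∀ s, deriv h s = b + c * s) (t : ℝ) : h t = h 0 + b * t + c * t ^ 2 / 2 := by
  have hder : ∀ x, HasDerivAt (fun x => h x - (b * x + c * x ^ 2 / 2)) 0 x := by
    intro x
    have h1 := (hh x).hasDerivAt.sub
      (((hasDerivAt_id x).const_mul b).add ((((hasDerivAt_id x).pow 2).const_mul c).div_const 2))
    refine h1.congr_deriv ?_
    rw [hd]
    simp
    ring
  have := is_const_of_deriv_eq_zero (fun x => (hder x).differentiableAt)
    (fun x => (hder x).deriv) t 0
  simp at this
  linarith

/-- If `u ↦ ∑ i, h (u i)` is differentiable and invariant under an infinite group of rotations,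
then `h` is a quadratic polynomial. -/
theorem exists_quadratic_of_sum_invariant {d : ℕ}
    (G : Subgroup (Matrix.specialOrthogonalGroup (Fin d) ℝ)) (hG : Infinite G)
    {h : ℝ → ℝ} (hh : Differentiable ℝ h)
    (hinv : ∀ g ∈ G, ∀ u, ∑ i, h (((g : Matrix (Fin d) (Fin d) ℝ) *ᵥ u) i) = ∑ i, h (u i)) :
    ∃ a b c : ℝ, ∀ t, h t = a + b * t + c * t ^ 2 / 2 := by
  obtain ⟨g, hgG, hg1, hg⟩ := exists_seq_tendsto_one_of_infinite G hG
  obtain ⟨A, hA0, hskew, φ, c, hc, hA⟩ := exists_skew_generator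
    (fun n => (g n : Matrix (Fin d) (Fin d) ℝ))
    (fun n => transpose_mul_self_of_mem_specialOrthogonalGroup (g n))
    (fun n hn => hg1 n (Subtype.ext hn)) hg
  obtain ⟨b, c', hbc⟩ := exists_affine_of_sum_mul_mulVec_eq_zero hA0 hskew
    (sum_deriv_mul_mulVec_eq_zero hh (fun n u => hinv _ (hgG (φ n)) u) hc hA)
  exact ⟨h 0, b, c', eq_quadratic_of_deriv_affine hh hbc⟩

end Generator

/-! ### Gaussian weights on the line -/

section Weight

open Real

/-- The measure `e^{-y²/2} μ(dy)`. For a finite measure `μ`, all its exponential moments are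
finite. -/
noncomputable def gaussianWeighted (μ : Measure ℝ) : Measure ℝ :=
  μ.withDensity fun y => ENNReal.ofReal (exp (-y ^ 2 / 2))

theorem integral_gaussianWeighted (μ : Measure ℝ) (f : ℝ → ℝ) :
    ∫ y, f y ∂gaussianWeighted μ = ∫ y, exp (-y ^ 2 / 2) * f y ∂μ := by
  rw [gaussianWeighted, integral_withDensity_eq_integral_toReal_smul (by fun_prop)
    (.of_forall fun _ => ENNReal.ofReal_lt_top)]
  simp [ENNReal.toReal_ofReal (exp_pos _).le]

theorem mgf_gaussianWeighted (μ : Measure ℝ) (t : ℝ) :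
    mgf id (gaussianWeighted μ) t = ∫ y, exp (t * y - y ^ 2 / 2) ∂μ := by
  rw [mgf, integral_gaussianWeighted]
  congr with y
  rw [← exp_add]
  congr 1
  simp only [id]
  ring

theorem integrable_exp_mul_gaussianWeighted (μ : Measure ℝ) [IsFiniteMeasure μ] (t : ℝ) :
    Integrable (fun y => exp (t * y)) (gaussianWeighted μ) := by
  rw [gaussianWeighted, integrable_withDensity_iff_integrable_smul' (by fun_prop)
    (.of_forall fun _ => ENNReal.ofReal_lt_top)]
  refine Integrable.of_bound (by fun_prop) (exp (t ^ 2 / 2)) (.of_forall fun y => ?_)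
  rw [ENNReal.toReal_ofReal (exp_pos _).le, smul_eq_mul, ← exp_add, norm_eq_abs, abs_exp,
    exp_le_exp]
  nlinarith [sq_nonneg (t - y)]

theorem integrableExpSet_gaussianWeighted (μ : Measure ℝ) [IsFiniteMeasure μ] :
    integrableExpSet id (gaussianWeighted μ) = Set.univ :=
  Set.eq_univ_of_forall fun t => integrable_exp_mul_gaussianWeighted μ t

instance isFiniteMeasure_gaussianWeighted (μ : Measure ℝ) [IsFiniteMeasure μ] :
    IsFiniteMeasure (gaussianWeighted μ) := by
  have h := integrable_exp_mul_gaussianWeighted μ 0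
  simp only [zero_mul, exp_zero] at h
  exact (integrable_const_iff_isFiniteMeasure one_ne_zero).1 h

theorem withDensity_gaussianWeighted (μ : Measure ℝ) :
    (gaussianWeighted μ).withDensity (fun y => ENNReal.ofReal (exp (y ^ 2 / 2))) = μ := by
  rw [gaussianWeighted, ← withDensity_mul _ (by fun_prop) (by fun_prop)]
  convert withDensity_one
  ext y
  rw [Pi.mul_apply, ← ENNReal.ofReal_mul (exp_pos _).le, ← exp_add, Pi.one_apply]
  simp [neg_div]

instance neZero_gaussianWeighted (μ : Measure ℝ) [NeZero μ] : NeZero (gaussianWeighted μ) where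
  out h := by
    have := withDensity_gaussianWeighted μ
    rw [h, withDensity_zero_left] at this
    exact NeZero.ne μ this.symm

theorem mgf_gaussianWeighted_pos (μ : Measure ℝ) [IsFiniteMeasure μ] [NeZero μ] (t : ℝ) :
    0 < mgf id (gaussianWeighted μ) t :=
  mgf_pos' (NeZero.ne _) (integrable_exp_mul_gaussianWeighted μ t)

theorem differentiable_cgf_gaussianWeighted (μ : Measure ℝ) [IsFiniteMeasure μ] [NeZero μ] :
    Differentiable ℝ (cgf id (gaussianWeighted μ)) := fun t =>
  (differentiableAt_mgf (by simp [integrableExpSet_gaussianWeighted])).log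
    (mgf_gaussianWeighted_pos μ t).ne'

/-- A finite measure on the line with everywhere finite exponential moments and quadratic cumulant
generating function is a multiple of a Gaussian measure. -/
theorem exists_eq_smul_gaussianReal_of_cgf {ν : Measure ℝ} [IsFiniteMeasure ν] [NeZero ν]
    (hexp : integrableExpSet id ν = Set.univ) {a b c : ℝ}
    (hcgf : ∀ t, cgf id ν t = a + b * t + c * t ^ 2 / 2) :
    ∃ v : NNReal, ν = ENNReal.ofReal (exp a) • gaussianReal b v := by
  have hc : 0 ≤ c := by
    -- `c` is the second derivative of the cumulant generating function at `0`, hence a variance.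
    have h0 : (0 : ℝ) ∈ interior (integrableExpSet id ν) := by simp [hexp]
    have hvar := variance_tilted_mul h0
    have h2 : iteratedDeriv 2 (cgf id ν) 0 = c := by
      have hd1 : deriv (cgf id ν) = fun t => b + c * t := by
        rw [funext hcgf]
        ext t
        have h1 := ((((hasDerivAt_id t).const_mul b).const_add a).add
          ((((hasDerivAt_id t).pow 2).const_mul c).div_const 2))
        refine (h1.congr_deriv ?_).deriv
        simp
        ring
      rw [iteratedDeriv_succ, iteratedDeriv_one, hd1]
      simp
    rw [← h2, ← hvar]
    exact variance_nonneg _ _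
  lift c to NNReal using hc
  refine ⟨c, ?_⟩
  have hfin : IsFiniteMeasure (ENNReal.ofReal (exp a) • gaussianReal b c) :=
    (gaussianReal b c).smul_finite ENNReal.ofReal_ne_top
  have hmgf : mgf id ν = mgf id (ENNReal.ofReal (exp a) • gaussianReal b c) := by
    ext t
    rw [mgf_smul_measure, mgf_id_gaussianReal, ENNReal.toReal_ofReal (exp_pos _).le,
      ← exp_cgf (hexp ▸ Set.mem_univ t : t ∈ integrableExpSet id ν), hcgf, ← exp_add]
    congr 1
    ring
  refine Measure.ext_of_complexMGF_id_eq (funext fun z => ?_)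
  exact eqOn_complexMGF_of_mgf' hmgf (by simp [exp_pos, NeZero.ne]) (by simp [hexp])

/-- A probability measure whose density is the exponential of a quadratic polynomial is Gaussian:
integrability forces the leading coefficient to be negative. -/
theorem isGaussian_withDensity_exp_quadratic {α β γ : ℝ}
    (hprob : IsProbabilityMeasure
      (volume.withDensity fun y => ENNReal.ofReal (exp (α + β * y + γ * y ^ 2)))) :
    IsGaussian (volume.withDensity fun y => ENNReal.ofReal (exp (α + β * y + γ * y ^ 2))) := by
  have hone : ∫⁻ y, ENNReal.ofReal (exp (α + β * y + γ * y ^ 2)) = 1 := by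
    have := hprob.measure_univ
    rwa [withDensity_apply _ MeasurableSet.univ, Measure.restrict_univ] at this
  have hint : Integrable fun y => exp (α + β * y + γ * y ^ 2) :=
    ⟨by fun_prop, by
      rw [hasFiniteIntegral_iff_ofReal (.of_forall fun _ => (exp_pos _).le), hone]
      exact ENNReal.one_lt_top⟩
  have hγ : γ < 0 := by
    by_contra! hγ
    -- The even part of the density is bounded below by a positive constant.
    have hconst : Integrable fun _ : ℝ => exp α := by
      refine (hint.add hint.comp_neg).mono' (by fun_prop) (.of_forall fun y => ?_)
      rw [norm_eq_abs, abs_exp]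
      have hy := mul_nonneg hγ (sq_nonneg y)
      rcases le_total 0 (β * y) with h | h
      · exact (exp_le_exp.2 (by linarith)).trans (le_add_of_nonneg_right (exp_pos _).le)
      · refine (exp_le_exp.2 ?_).trans (le_add_of_nonneg_left (exp_pos _).le)
        simp only [mul_neg, even_two.neg_pow]
        linarith
    rw [integrable_const_iff] at hconst
    simp [exp_ne_zero, isFiniteMeasure_iff] at hconst
  -- Completing the square identifies the density up to a constant factor.
  have hv0 : 0 < -1 / (2 * γ) := div_pos_of_neg_of_neg (by norm_num) (by linarith)
  obtain ⟨v, hv⟩ : ∃ v : NNReal, (v : ℝ) = -1 / (2 * γ) := ⟨⟨_, hv0.le⟩, rfl⟩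
  have hvne : v ≠ 0 := by
    rintro rfl
    exact hv0.ne hv
  let m : ℝ := β * v
  let K : ℝ := exp (α + β * m / 2) * √(2 * π * v)
  have hvpos : 0 < (v : ℝ) := hv ▸ hv0
  have hKpos : 0 < K := by positivity
  have hdens : (fun y => ENNReal.ofReal (exp (α + β * y + γ * y ^ 2)))
      = ENNReal.ofReal K • gaussianPDF m v := by
    ext y
    rw [Pi.smul_apply, gaussianPDF, smul_eq_mul, ← ENNReal.ofReal_mul hKpos.le,
      gaussianPDFReal]
    congr 1
    have hs : √(2 * π * v) ≠ 0 := by positivity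
    rw [show K * ((√(2 * π * v))⁻¹ * exp (-(y - m) ^ 2 / (2 * v)))
      = exp (α + β * m / 2) * exp (-(y - m) ^ 2 / (2 * v)) by simp only [K]; field_simp, ← exp_add]
    congr 1
    have hγv : γ = -1 / (2 * v) := by
      rw [hv]
      field_simp
    rw [hγv]
    simp only [m]
    field_simp
    ring
  have hK1 : ENNReal.ofReal K = 1 := by
    have h : ∫⁻ y, ENNReal.ofReal K * gaussianPDF m v y = 1 := by
      rw [← hone]
      exact lintegral_congr fun y => (congrFun hdens y).symm
    rwa [lintegral_const_mul _ (measurable_gaussianPDF _ _), lintegral_gaussianPDF_eq_one _ hvne,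
      mul_one] at h
  rw [hdens, hK1, one_smul, ← gaussianReal_of_var_ne_zero _ hvne]
  infer_instance

/-- A probability measure `μ` is Gaussian as soon as `e^{-y²/2} μ(dy)` is a multiple of a
Gaussian measure. -/
theorem isGaussian_of_gaussianWeighted_eq_smul {μ : Measure ℝ} [hμ : IsProbabilityMeasure μ]
    {a b : ℝ} {v : NNReal}
    (h : gaussianWeighted μ = ENNReal.ofReal (exp a) • gaussianReal b v) : IsGaussian μ := by
  have hback := withDensity_gaussianWeighted μ
  rw [h, withDensity_smul_measure] at hback
  by_cases hv : v = 0
  · subst hv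
    have hdirac : μ = (ENNReal.ofReal (exp a) * ENNReal.ofReal (exp (b ^ 2 / 2))) •
        Measure.dirac b := by
      rw [← hback, gaussianReal_zero_var, dirac_withDensity, smul_smul]
    have hone := hμ.measure_univ
    rw [hdirac] at hone
    simp only [Measure.smul_apply, measure_univ, smul_eq_mul, mul_one] at hone
    rw [hdirac, hone, one_smul]
    infer_instance
  · have hv' : (0 : ℝ) < v := by positivity
    have hμ' : μ = volume.withDensity fun y => ENNReal.ofReal
        (exp ((a - log √(2 * π * v) - b ^ 2 / (2 * v)) + b / v * y
          + (1 / 2 - 1 / (2 * v)) * y ^ 2)) := by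
      rw [← hback, gaussianReal_of_var_ne_zero _ hv,
        ← withDensity_mul _ (measurable_gaussianPDF _ _) (by fun_prop),
        ← withDensity_smul _ (by fun_prop)]
      congr 1
      ext y
      have hs : 0 < √(2 * π * v) := by positivity
      simp only [Pi.smul_apply, Pi.mul_apply, gaussianPDF, smul_eq_mul]
      rw [← ENNReal.ofReal_mul (gaussianPDFReal_nonneg _ _ _),
        ← ENNReal.ofReal_mul (exp_pos _).le, gaussianPDFReal]
      congr 1
      rw [← exp_log (inv_pos.2 hs), ← exp_add, ← exp_add, ← exp_add, log_inv]
      congr 1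
      field_simp
      ring
    rw [hμ'] at hμ ⊢
    exact isGaussian_withDensity_exp_quadratic hμ

end Weight

/-! ### Invariance and independence -/

section Invariance

open Matrix Real

theorem coe_rotationRep_apply {d : ℕ} (g : Matrix.specialOrthogonalGroup (Fin d) ℝ)
    (x : EuclideanSpace ℝ (Fin d)) :
    ⇑(rotationRep d g x) = (g : Matrix (Fin d) (Fin d) ℝ) *ᵥ ⇑x :=
  funext (rotationRep_apply d g x)

theorem mulVec_dotProduct_rotationRep_apply {d : ℕ} (g : Matrix.specialOrthogonalGroup (Fin d) ℝ)
    (u : Fin d → ℝ) (x : EuclideanSpace ℝ (Fin d)) :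
    ((g : Matrix (Fin d) (Fin d) ℝ) *ᵥ u) ⬝ᵥ ⇑(rotationRep d g x) = u ⬝ᵥ ⇑x := by
  rw [coe_rotationRep_apply, dotProduct_mulVec, vecMul_mulVec, ← mulVec_transpose, transpose_mul,
    transpose_transpose, transpose_mul_self_of_mem_specialOrthogonalGroup, one_mulVec]

theorem sum_sq_rotationRep_apply {d : ℕ} (g : Matrix.specialOrthogonalGroup (Fin d) ℝ)
    (x : EuclideanSpace ℝ (Fin d)) : ∑ i, rotationRep d g x i ^ 2 = ∑ i, x i ^ 2 := by
  have h := mulVec_dotProduct_rotationRep_apply g (⇑x) x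
  rw [← coe_rotationRep_apply] at h
  simpa only [dotProduct, ← sq] using h

/-- For a `G`-invariant vector with independent coordinates of common law `μ`, the function
`u ↦ E[exp (⟨u, X⟩ - |X|²/2)]` is `G`-invariant and is the product of the moment generating
functions of `e^{-y²/2} μ(dy)` at the coordinates of `u`; this is its logarithm. -/
theorem sum_cgf_gaussianWeighted_invariant {d : ℕ} {Ω : Type*} [MeasurableSpace Ω] {P : Measure Ω}
    {X : Ω → EuclideanSpace ℝ (Fin d)} (hX : AEMeasurable X P)
    {G : Subgroup (Matrix.specialOrthogonalGroup (Fin d) ℝ)} (hinv : LawInvariantUnder G X P)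
    (hindep : iIndepFun (fun (i : Fin d) ω => X ω i) P)
    {μ : Measure ℝ} [IsProbabilityMeasure μ] (hμ : ∀ i, P.map (fun ω => X ω i) = μ)
    {g : Matrix.specialOrthogonalGroup (Fin d) ℝ} (hg : g ∈ G) (u : Fin d → ℝ) :
    ∑ i, cgf id (gaussianWeighted μ) (((g : Matrix (Fin d) (Fin d) ℝ) *ᵥ u) i)
      = ∑ i, cgf id (gaussianWeighted μ) (u i) := by
  have hXi : ∀ i, AEMeasurable (fun ω => X ω i) P := fun i => by fun_prop
  let ψ (w : Fin d → ℝ) (x : EuclideanSpace ℝ (Fin d)) : ℝ := ∏ i, exp (w i * x i - x i ^ 2 / 2)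
  have hψ : ∀ w, Measurable (ψ w) := fun w => by fun_prop
  have hprod : ∀ w, ∫ ω, ψ w (X ω) ∂P = ∏ i, mgf id (gaussianWeighted μ) (w i) := by
    intro w
    rw [hindep.integral_fun_prod_comp (f := fun i y => exp (w i * y - y ^ 2 / 2)) hXi
      (fun i => by fun_prop)]
    refine Finset.prod_congr rfl fun i _ => ?_
    rw [mgf_gaussianWeighted, ← hμ i, integral_map (hXi i) (by fun_prop)]
  have hψg : ∀ x, ψ ((g : Matrix (Fin d) (Fin d) ℝ) *ᵥ u) (rotationRep d g x) = ψ u x := by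
    intro x
    simp only [ψ, ← exp_sum, Finset.sum_sub_distrib, ← Finset.sum_div, sum_sq_rotationRep_apply]
    congr 2
    exact mulVec_dotProduct_rotationRep_apply g u x
  have hgX : AEMeasurable (fun ω => rotationRep d g (X ω)) P :=
    ((rotationRep d g).continuous_of_finiteDimensional.measurable).comp_aemeasurable hX
  have key : ∏ i, mgf id (gaussianWeighted μ) (((g : Matrix (Fin d) (Fin d) ℝ) *ᵥ u) i)
      = ∏ i, mgf id (gaussianWeighted μ) (u i) := by
    rw [← hprod, ← hprod, ← integral_map hX (hψ _).aestronglyMeasurable, ← hinv g hg,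
      integral_map hgX (hψ _).aestronglyMeasurable]
    simp only [hψg]
  simp only [cgf]
  rw [← log_prod (fun i _ => (mgf_gaussianWeighted_pos μ _).ne'), key,
    log_prod (fun i _ => (mgf_gaussianWeighted_pos μ _).ne')]

end Invariance

theorem theorem4p1 {d : ℕ} {Ω : Type*} [MeasurableSpace Ω] (P : Measure Ω)
    [IsProbabilityMeasure P] (X : Ω → EuclideanSpace ℝ (Fin d)) (hX : AEMeasurable X P)
    (G : Subgroup (Matrix.specialOrthogonalGroup (Fin d) ℝ))
    (hGinf : Infinite G) (hGirr : ActsIrreducibly G)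
    (hinv : LawInvariantUnder G X P)
    (hident : ∀ i j : Fin d, IdentDistrib (fun ω => X ω i) (fun ω => X ω j) P P)
    (hindep : iIndepFun (fun (i : Fin d) ω => X ω i) P) :
    HasGaussianLaw X P := by
  have hXi : ∀ i, AEMeasurable (fun ω => X ω i) P := fun i => by fun_prop
  have hcoord : ∀ i, HasGaussianLaw (fun ω => X ω i) P := by
    intro i
    have hμ : IsProbabilityMeasure (P.map fun ω => X ω i) :=
      Measure.isProbabilityMeasure_map (hXi i)
    obtain ⟨a, b, c, habc⟩ := exists_quadratic_of_sum_invariant G hGinf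
      (differentiable_cgf_gaussianWeighted (P.map fun ω => X ω i))
      (fun g hg u => sum_cgf_gaussianWeighted_invariant hX hinv hindep
        (fun j => (hident j i).map_eq) hg u)
    obtain ⟨v, hv⟩ := exists_eq_smul_gaussianReal_of_cgf
      (integrableExpSet_gaussianWeighted (P.map fun ω => X ω i)) habc
    exact ⟨isGaussian_of_gaussianWeighted_eq_smul hv⟩
  exact (hindep.hasGaussianLaw hcoord).toLp_pi 2
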